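/- Let $S_n$ be the group of permutations $w=w_1w_2\cdots w_n$ of $\{1,\dots,n\}$, let $s_i$ be the simple transposition interchanging $i$ and $i+1$, and let $t_{i,j}$ be the transposition interchanging $i$ and $j$, so that $wt_{i,j}$ is obtained from $w$ by swapping the entries $w_i$ and $w_j$. Let $\ell(w)$ be the least number of simple transpositions in a decomposition of $w$; a word $(a_1,\dots,a_\ell)$ with $w=s_{a_1}\cdots s_{a_\ell}$ and $\ell=\ell(w)$ is a reduced word of $w$. The Stanley symmetric function of $w$ is the formal power series $$F_w(x)=\sum_{(a_1,\dots,a_\ell)}\ \sum_{\substack{1\le b_1\le b_2\le\cdots\le b_\ell\\ a_i<a_{i+1}\Rightarrow b_i<b_{i+1}}}x_{b_1}x_{b_2}\cdots x_{b_\ell},$$ where $(a_1,\dots,a_\ell)$ ranges over the reduced words of $w$. For $u\in S_n$ and $1\le k\le n$ let $$I(u,k)=\{i<k \mid \ell(ut_{i,k})=\ell(u)+1\},$$ and let $\Phi(u,k)=\{ut_{i,k}\mid i\in I(u,k)\}$ if $I(u,k)\neq\emptyset$, and $\Phi(u,k)=\Phi(1\times u,k+1)$ otherwise, where $1\times u=1(u_1+1)\cdots(u_n+1)\in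 S_{n+1}$. Theorem. Let $w\in S_n$ be non-dominant, that is, there are indices $i<t<j$ with $w_i<w_j<w_t$ (a 132 pattern). Let $$p=\max\{t\mid \exists\, i<t<j \text{ such that } w_i<w_j<w_t\},$$ $$q=\max\{j>p\mid w_j<w_p \text{ and } w_i<w_j\text{ for some } i<p\}.$$ Then $$F_w(x)=\sum_{w'\in\Phi(wt_{p,q},p)}F_{w'}(x).$$ Moreover, the set $I(wt_{p,q},p)$ is nonempty, and every permutation in $\Phi(wt_{p,q},p)$ is a permutation of $\{1,\dots,n\}$, that is, lies in $S_n$. -/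

import Mathlib

noncomputable section

namespace StanleySymm

open Equiv

/-- The simple transposition `s_i`, interchanging `i` and `i + 1` (positions and values are
numbered from `0`). -/
def simpleTransposition {n : ℕ} (i : Fin (n - 1)) : Perm (Fin n) :=
  Equiv.swap ⟨i, by omega⟩ ⟨i + 1, by omega⟩

/-- The product `s_{a_1} s_{a_2} ⋯ s_{a_ℓ}`. -/
def wordProd {n : ℕ} (a : List (Fin (n - 1))) : Perm (Fin n) :=
  (a.map simpleTransposition).prod

/-- `a` is a reduced word of `w`: its product is `w`, with the least possible number of letters. -/
def IsReducedWord {n : ℕ} (w : Perm (Fin n)) (a : List (Fin (n - 1))) : Prop :=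
  wordProd a = w ∧ ∀ b : List (Fin (n - 1)), wordProd b = w → a.length ≤ b.length

/-- The length `ℓ(w)`: the least number of simple transpositions in a decomposition of `w`. -/
def length {n : ℕ} (w : Perm (Fin n)) : ℕ :=
  sInf {m : ℕ | ∃ a : List (Fin (n - 1)), wordProd a = w ∧ a.length = m}

/-- The pairs of sequences `(a_1, …, a_ℓ)`, `(b_1, …, b_ℓ)`, written as the list of the pairs
`(a_i, b_i)`, such that `a` is a reduced word of `w`, `b_1 ≤ ⋯ ≤ b_ℓ`,
`a_i < a_{i+1}` implies `b_i < b_{i+1}`, and `x_{b_1} ⋯ x_{b_ℓ}` is the monomial with exponent `m`.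
-/
def compatiblePairs {n : ℕ} (w : Perm (Fin n)) (m : ℕ →₀ ℕ) : Set (List (Fin (n - 1) × ℕ)) :=
  {c | IsReducedWord w (c.map Prod.fst) ∧
    c.IsChain (fun x y => x.2 ≤ y.2 ∧ (x.1 < y.1 → x.2 < y.2)) ∧
    Multiset.toFinsupp (c.map Prod.snd : Multiset ℕ) = m}

/-- Each monomial arises only finitely often, so that its coefficient is an honest count. -/
theorem compatiblePairs_finite {n : ℕ} (w : Perm (Fin n)) (m : ℕ →₀ ℕ) :
    (compatiblePairs w m).Finite := by
  let S : Set (Fin (n - 1) × ℕ) := Set.univ ×ˢ (m.support : Set ℕ)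
  have hS : S.Finite := Set.finite_univ.prod m.support.finite_toSet
  have : Finite S := hS
  refine ((List.finite_length_eq S m.toMultiset.card).image (List.map Subtype.val)).subset ?_
  rintro c ⟨-, -, hc⟩
  have hm : (c.map Prod.snd : Multiset ℕ) = m.toMultiset := by
    rw [← hc, Multiset.toFinsupp_toMultiset]
  have hmem : ∀ x ∈ c, x ∈ S := by
    intro x hx
    refine ⟨trivial, ?_⟩
    rw [← hc]
    simpa using ⟨x.1, hx⟩
  refine ⟨c.attach.map (fun x => ⟨x.1, hmem x.1 x.2⟩), ?_, ?_⟩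
  · simp [← hm]
  · rw [List.map_map]
    exact List.attach_map_subtype_val c

/-- The Stanley symmetric function `F_w`, a formal power series in infinitely many variables:
the sum of `x_{b_1} ⋯ x_{b_ℓ}` over all reduced words `a` of `w` and all `b_1 ≤ ⋯ ≤ b_ℓ` with
`b_i < b_{i+1}` whenever `a_i < a_{i+1}`. -/
def stanley {n : ℕ} (w : Perm (Fin n)) : MvPowerSeries ℕ ℤ :=
  fun m => ((compatiblePairs w m).ncard : ℤ)

/-- The positions `i < k` with `ℓ(u t_{i,k}) = ℓ(u) + 1`. -/
def I {n : ℕ} (u : Perm (Fin n)) (k : Fin n) : Set (Fin n) :=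
  {i | i < k ∧ length (u * Equiv.swap i k) = length u + 1}

/-- The permutation `1 × u = 1 (u_1 + 1) ⋯ (u_n + 1)`. -/
def oneTimes {n : ℕ} (u : Perm (Fin n)) : Perm (Fin (n + 1)) :=
  Equiv.Perm.decomposeFin.symm (0, u)

theorem oneTimes_zero {n : ℕ} (u : Perm (Fin n)) : oneTimes u 0 = 0 := by
  simp [oneTimes]

theorem oneTimes_succ {n : ℕ} (u : Perm (Fin n)) (i : Fin n) :
    oneTimes u i.succ = (u i).succ := by
  simp [oneTimes]

/-- Membership in `Φ(u, k)`, which is `{u t_{i,k} | i ∈ I(u, k)}` if `I(u, k)` is nonempty and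
`Φ(1 × u, k + 1)` otherwise. -/
inductive MemPhi : {n : ℕ} → Perm (Fin n) → Fin n → (Σ m : ℕ, Perm (Fin m)) → Prop
  | child {n : ℕ} {u : Perm (Fin n)} {k i : Fin n} (hi : i ∈ I u k) :
      MemPhi u k ⟨n, u * Equiv.swap i k⟩
  | shift {n : ℕ} {u : Perm (Fin n)} {k : Fin n} {v : Σ m : ℕ, Perm (Fin m)} (h : I u k = ∅)
      (hv : MemPhi (oneTimes u) k.succ v) : MemPhi u k v

/-- The set `Φ(u, k)`; its members are permutations of possibly larger size than `u`. -/
def Phi {n : ℕ} (u : Perm (Fin n)) (k : Fin n) : Set (Σ m : ℕ, Perm (Fin m)) :=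
  {v | MemPhi u k v}

/-- `w` is dominant: it avoids the pattern `132`. -/
def IsDominant {n : ℕ} (w : Perm (Fin n)) : Prop :=
  ¬ ∃ i t j : Fin n, i < t ∧ t < j ∧ w i < w j ∧ w j < w t

/-- The positions `t` of the middle entries of the `132` patterns of `w`. -/
def middlePositions {n : ℕ} (w : Perm (Fin n)) : Finset (Fin n) :=
  {t | ∃ i j : Fin n, i < t ∧ t < j ∧ w i < w j ∧ w j < w t}

theorem middlePositions_nonempty {n : ℕ} {w : Perm (Fin n)} (hw : ¬ IsDominant w) :
    (middlePositions w).Nonempty := by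
  obtain ⟨i, t, j, h⟩ := not_not.mp hw
  exact ⟨t, by simpa [middlePositions] using ⟨i, h.1, j, h.2⟩⟩

/-- The index `p`: the last position of the middle entry of a `132` pattern. -/
def pIndex {n : ℕ} (w : Perm (Fin n)) (hw : ¬ IsDominant w) : Fin n :=
  (middlePositions w).max' (middlePositions_nonempty hw)

/-- The positions `j > p` with `w_j < w_p` and `w_i < w_j` for some `i < p`. -/
def lastPositions {n : ℕ} (w : Perm (Fin n)) (p : Fin n) : Finset (Fin n) :=
  {j | p < j ∧ w j < w p ∧ ∃ i : Fin n, i < p ∧ w i < w j}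

theorem lastPositions_nonempty {n : ℕ} {w : Perm (Fin n)} (hw : ¬ IsDominant w) :
    (lastPositions w (pIndex w hw)).Nonempty := by
  have h := (middlePositions w).max'_mem (middlePositions_nonempty hw)
  obtain ⟨i, j, hi, hj, hij, hjt⟩ := (Finset.mem_filter.mp h).2
  exact ⟨j, Finset.mem_filter.mpr ⟨Finset.mem_univ _, hj, hjt, i, hi, hij⟩⟩

/-- The index `q`: the largest `j > p` with `w_j < w_p` and `w_i < w_j` for some `i < p`. -/
def qIndex {n : ℕ} (w : Perm (Fin n)) (hw : ¬ IsDominant w) : Fin n :=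
  (lastPositions w (pIndex w hw)).max' (lastPositions_nonempty hw)

end StanleySymm

end

namespace StanleySymm

open Equiv

/-! In the nil-Coxeter algebra, multiply the rows (1 + x_b u_{n-2}) ⋯ (1 + x_b u_0) over finitely
many b. The coefficient at u_w is F_w in those variables (`coeff_factorProd`,
`exists_coeff_stanley_eq`). The signed sum `coverSum k` over the Bruhat covers v t_{j,k} almost
commutes with left multiplication by u_i: the error is supported where v_k is i or i + 1
(`coverSum_nilMul`). Along a row these errors telescope (`coverSum_rowMul`), leaving only boundary
terms where v_k is the least or greatest value; such v are extremal. Since non-extremality passes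
from v to a shorter s_i v, induction on the rows shows that `coverSum k` of the whole product
vanishes at every non-extremal v. Hence the Stanley functions of the covers with j < k and of those
with j > k have equal sums (`sum_covers_left_eq_sum_covers_right`).

Take v = u = w t_{p,q} and k = p. Maximality of p and of q leaves w as the only cover to the right
(`covers_right_pIndex`). The covers to the left are indexed by I(u, p), which is nonempty because
the pattern has a smaller entry left of p, so Φ never passes to a larger group. -/

/-! ### Inversions and simple transpositions -/

/-- The number of inversions of a permutation. -/
def inv {n : ℕ} (w : Perm (Fin n)) : ℕ :=
  (Finset.univ.filter fun x : Fin n × Fin n => x.1 < x.2 ∧ w x.2 < w x.1).card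

theorem inv_one {n : ℕ} : inv (1 : Perm (Fin n)) = 0 := by
  rw [inv, Finset.card_eq_zero, Finset.filter_eq_empty_iff]
  rintro x - ⟨h1, h2⟩
  exact lt_asymm h1 h2

theorem simpleTransposition_mul_self {n : ℕ} (i : Fin (n - 1)) :
    simpleTransposition i * simpleTransposition i = 1 :=
  Equiv.swap_mul_self _ _

theorem simpleTransposition_mul_cancel {n : ℕ} (i : Fin (n - 1)) (w : Perm (Fin n)) :
    simpleTransposition i * (simpleTransposition i * w) = w := by
  rw [← mul_assoc, simpleTransposition_mul_self, one_mul]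

theorem simpleTransposition_val {n : ℕ} (i : Fin (n - 1)) (a : Fin n) :
    (simpleTransposition i a : ℕ) =
      if (a : ℕ) = i then (i : ℕ) + 1 else if (a : ℕ) = i + 1 then (i : ℕ) else a := by
  rw [simpleTransposition, Equiv.swap_apply_def]
  simp only [Fin.ext_iff]
  split_ifs <;> rfl

theorem simpleTransposition_lt_iff {n : ℕ} (i : Fin (n - 1)) {a b : Fin n}
    (h : ¬ ((a : ℕ) = i ∧ (b : ℕ) = i + 1)) (h' : ¬ ((b : ℕ) = i ∧ (a : ℕ) = i + 1)) :
    simpleTransposition i a < simpleTransposition i b ↔ a < b := by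
  rw [Fin.lt_def, Fin.lt_def, simpleTransposition_val, simpleTransposition_val]
  split_ifs <;> omega

/-- Only the values `i` and `i + 1` change their relative order, so the one pair gained is `(a, b)`.
-/
theorem inv_simpleTransposition_mul_of_lt {n : ℕ} (i : Fin (n - 1)) (w : Perm (Fin n))
    {a b : Fin n} (ha : (w a : ℕ) = i) (hb : (w b : ℕ) = i + 1) (hab : a < b) :
    inv (simpleTransposition i * w) = inv w + 1 := by
  have hnot : (a, b) ∉ Finset.univ.filter
      fun x : Fin n × Fin n => x.1 < x.2 ∧ w x.2 < w x.1 := by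
    simp only [Finset.mem_filter, not_and]
    intro _ _
    rw [Fin.lt_def]
    omega
  rw [inv, inv, ← Finset.card_insert_of_notMem hnot]
  congr 1
  ext ⟨c, d⟩
  simp only [Finset.mem_filter, Finset.mem_univ, true_and, Finset.mem_insert, Prod.mk.injEq]
  simp only [Perm.mul_apply]
  have hinj : ∀ {x y : Fin n}, (w x : ℕ) = w y → x = y := fun h => w.injective (Fin.ext h)
  by_cases h1 : (w c : ℕ) = i ∧ (w d : ℕ) = i + 1
  · obtain rfl : c = a := hinj (h1.1.trans ha.symm)
    obtain rfl : d = b := hinj (h1.2.trans hb.symm)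
    simp only [hab, Fin.lt_def, simpleTransposition_val, ha, hb]
    simp
  by_cases h2 : (w d : ℕ) = i ∧ (w c : ℕ) = i + 1
  · obtain rfl : d = a := hinj (h2.1.trans ha.symm)
    obtain rfl : c = b := hinj (h2.2.trans hb.symm)
    have h3 : ¬ c < d := not_lt_of_gt hab
    have h4 : c ≠ d := hab.ne'
    simp [h3, h4]
  · rw [simpleTransposition_lt_iff i h2 h1]
    refine ⟨Or.inr, ?_⟩
    rintro (⟨rfl, rfl⟩ | h)
    · exact absurd ⟨ha, hb⟩ h1
    · exact h

theorem inv_simpleTransposition_mul_of_gt {n : ℕ} (i : Fin (n - 1)) (w : Perm (Fin n))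
    {a b : Fin n} (ha : (w a : ℕ) = i) (hb : (w b : ℕ) = i + 1) (hab : b < a) :
    inv w = inv (simpleTransposition i * w) + 1 := by
  have := inv_simpleTransposition_mul_of_lt i (simpleTransposition i * w) (a := b) (b := a)
    (by rw [Perm.mul_apply, simpleTransposition_val]; split_ifs <;> omega)
    (by rw [Perm.mul_apply, simpleTransposition_val, if_pos ha]) hab
  rwa [simpleTransposition_mul_cancel] at this

theorem exists_consecutive_values {n : ℕ} (i : Fin (n - 1)) (w : Perm (Fin n)) :
    ∃ a b : Fin n, (w a : ℕ) = i ∧ (w b : ℕ) = i + 1 ∧ a ≠ b := by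
  refine ⟨w.symm ⟨i, by omega⟩, w.symm ⟨i + 1, by omega⟩, by simp, by simp, ?_⟩
  intro h
  simpa using w.symm.injective h

theorem inv_simpleTransposition_mul {n : ℕ} (i : Fin (n - 1)) (w : Perm (Fin n)) :
    inv (simpleTransposition i * w) = inv w + 1 ∨ inv w = inv (simpleTransposition i * w) + 1 := by
  obtain ⟨a, b, ha, hb, hab⟩ := exists_consecutive_values i w
  rcases lt_or_gt_of_ne hab with h | h
  · exact Or.inl (inv_simpleTransposition_mul_of_lt i w ha hb h)
  · exact Or.inr (inv_simpleTransposition_mul_of_gt i w ha hb h)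

/-! ### Inversions and arbitrary transpositions: Bruhat covers -/

/-- Apply `t_{a,b}` to both positions of a pair, unless this reverses their order. -/
def swapPair {n : ℕ} (a b : Fin n) (x : Fin n × Fin n) : Fin n × Fin n :=
  if swap a b x.1 < swap a b x.2 then (swap a b x.1, swap a b x.2) else x

/-- On increasing pairs the map is an involution. -/
theorem swapPair_injOn {n : ℕ} (a b : Fin n) :
    Set.InjOn (swapPair a b) {x : Fin n × Fin n | x.1 < x.2} := by
  rintro ⟨c, d⟩ hx ⟨c', d'⟩ hx' he
  simp only [Set.mem_ofPred_eq] at hx hx'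
  simp only [swapPair] at he
  split_ifs at he with h1 h2 h2
  · simpa using he
  · rw [Prod.mk.injEq] at he
    obtain ⟨rfl, rfl⟩ := he
    rw [swap_apply_self, swap_apply_self] at h2
    exact absurd hx h2
  · rw [Prod.mk.injEq] at he
    obtain ⟨rfl, rfl⟩ := he
    rw [swap_apply_self, swap_apply_self] at h1
    exact absurd hx' h1
  · exact he

/-- These are the pairs that `swapPair` leaves in place; for them the inversion counts need a direct
comparison of entries. -/
theorem eq_or_eq_of_swap_reverses {n : ℕ} {a b c d : Fin n} (hab : a < b) (hcd : c < d)
    (h : ¬ swap a b c < swap a b d) :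
    (c = a ∧ d = b) ∨ (c = a ∧ d ≠ a ∧ d ≠ b ∧ a < d ∧ d < b) ∨
      (d = b ∧ c ≠ a ∧ c ≠ b ∧ a < c ∧ c < b) := by
  rw [swap_apply_def, swap_apply_def] at h
  split_ifs at h <;> grind

theorem swapPair_eq_iff {n : ℕ} {a b : Fin n} {x : Fin n × Fin n} (hab : a < b) (hx : x.1 < x.2) :
    swapPair a b x = (a, b) ↔ x = (a, b) := by
  obtain ⟨c, d⟩ := x
  constructor
  · intro he
    rw [swapPair] at he
    split_ifs at he
    · rw [Prod.mk.injEq] at he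
      have hc : c = b := by rw [← swap_apply_self a b c, he.1, swap_apply_left]
      have hd : d = a := by rw [← swap_apply_self a b d, he.2, swap_apply_right]
      subst hc hd
      exact absurd hx (lt_asymm hab)
    · exact he
  · intro he
    rw [he, swapPair, if_neg]
    simpa using hab.le

/-- `swapPair` embeds the inversions of `w` into those of `w t_{a,b}` and misses the new inversion
`(a, b)`. -/
theorem inv_lt_inv_mul_swap {n : ℕ} (w : Perm (Fin n)) {a b : Fin n} (hab : a < b)
    (h : w a < w b) : inv w < inv (w * swap a b) := by
  let S (u : Perm (Fin n)) := Finset.univ.filter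
    fun x : Fin n × Fin n => x.1 < x.2 ∧ u x.2 < u x.1
  have hmem : ((S w).image (swapPair a b)) ⊆ (S (w * swap a b)).erase (a, b) := by
    intro y hy
    obtain ⟨⟨c, d⟩, hx, rfl⟩ := Finset.mem_image.mp hy
    simp only [S, Finset.mem_filter, Finset.mem_univ, true_and] at hx
    obtain ⟨hcd, hw⟩ := hx
    have hne : (c, d) ≠ (a, b) := by
      rintro he
      rw [Prod.mk.injEq] at he
      rw [he.1, he.2] at hw
      exact lt_asymm h hw
    rw [Finset.mem_erase, Ne, swapPair_eq_iff hab hcd]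
    refine ⟨hne, ?_⟩
    simp only [S, swapPair, Finset.mem_filter, Finset.mem_univ, true_and]
    simp only [Perm.mul_apply]
    split_ifs with hlt
    · exact ⟨hlt, by simpa using hw⟩
    · refine ⟨hcd, ?_⟩
      rcases eq_or_eq_of_swap_reverses hab hcd hlt with ⟨rfl, rfl⟩ | ⟨rfl, h1, h2, -⟩ |
        ⟨rfl, h1, h2, -⟩
      · exact absurd rfl hne
      · rw [swap_apply_left, swap_apply_of_ne_of_ne h1 h2]
        exact hw.trans h
      · rw [swap_apply_right, swap_apply_of_ne_of_ne h1 h2]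
        exact h.trans hw
  have hab' : (a, b) ∈ S (w * swap a b) := by
    simp only [S, Finset.mem_filter, Finset.mem_univ, true_and]
    rw [Perm.mul_apply, Perm.mul_apply, swap_apply_left, swap_apply_right]
    exact ⟨hab, h⟩
  calc inv w = ((S w).image (swapPair a b)).card :=
        (Finset.card_image_of_injOn ((swapPair_injOn a b).mono
          fun x hx => (Finset.mem_filter.mp hx).2.1)).symm
    _ ≤ ((S (w * swap a b)).erase (a, b)).card := Finset.card_le_card hmem
    _ < (S (w * swap a b)).card := Finset.card_erase_lt_of_mem hab'
    _ = inv (w * swap a b) := rfl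

/-- The embedding also runs backwards: when no intermediate value lies between, every inversion of
`w t_{a,b}` except `(a, b)` goes to one of `w`. -/
theorem inv_mul_swap_le {n : ℕ} (w : Perm (Fin n)) {a b : Fin n} (hab : a < b)
    (h : ∀ c, a < c → c < b → ¬ (w a < w c ∧ w c < w b)) : inv (w * swap a b) ≤ inv w + 1 := by
  let S (u : Perm (Fin n)) := Finset.univ.filter
    fun x : Fin n × Fin n => x.1 < x.2 ∧ u x.2 < u x.1
  have hmem : (((S (w * swap a b)).erase (a, b)).image (swapPair a b)) ⊆ S w := by
    intro y hy
    obtain ⟨⟨c, d⟩, hx, rfl⟩ := Finset.mem_image.mp hy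
    simp only [S, Finset.mem_filter, Finset.mem_univ, true_and, Finset.mem_erase] at hx
    obtain ⟨hne, hcd, hw⟩ := hx
    rw [Perm.mul_apply, Perm.mul_apply] at hw
    simp only [S, swapPair, Finset.mem_filter, Finset.mem_univ, true_and]
    split_ifs with hlt
    · exact ⟨hlt, hw⟩
    · refine ⟨hcd, ?_⟩
      rcases eq_or_eq_of_swap_reverses hab hcd hlt with ⟨rfl, rfl⟩ | ⟨rfl, h1, h2, h3, h4⟩ |
        ⟨rfl, h1, h2, h3, h4⟩
      · exact absurd rfl hne
      · rw [swap_apply_left, swap_apply_of_ne_of_ne h1 h2] at hw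
        exact lt_of_le_of_ne (not_lt.mp fun h5 => h d h3 h4 ⟨h5, hw⟩)
          fun he => h1 (w.injective he)
      · rw [swap_apply_right, swap_apply_of_ne_of_ne h1 h2] at hw
        exact lt_of_le_of_ne (not_lt.mp fun h5 => h c h3 h4 ⟨hw, h5⟩)
          fun he => h2 (w.injective he.symm)
  have h1 := Finset.card_le_card hmem
  rw [Finset.card_image_of_injOn ((swapPair_injOn a b).mono
    fun x hx => (Finset.mem_filter.mp (Finset.mem_of_mem_erase hx)).2.1)] at h1
  have h2 := Finset.pred_card_le_card_erase (s := S (w * swap a b)) (a := (a, b))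
  change (S (w * swap a b)).card ≤ (S w).card + 1
  omega

theorem inv_lt_inv_mul_swap_iff {n : ℕ} (w : Perm (Fin n)) {a b : Fin n} (hab : a < b) :
    inv w < inv (w * swap a b) ↔ w a < w b := by
  refine ⟨fun h => ?_, inv_lt_inv_mul_swap w hab⟩
  by_contra hn
  have hlt : w b < w a := lt_of_le_of_ne (not_lt.mp hn) fun he => hab.ne' (w.injective he)
  have := inv_lt_inv_mul_swap (w * swap a b) hab (by simpa using hlt)
  rw [mul_assoc, swap_mul_self, mul_one] at this
  exact lt_asymm h this

/-- The Bruhat covers `w t_{a,b}` of `w`. -/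
theorem inv_mul_swap_eq_iff {n : ℕ} (w : Perm (Fin n)) {a b : Fin n} (hab : a < b) :
    inv (w * swap a b) = inv w + 1 ↔
      w a < w b ∧ ∀ c, a < c → c < b → ¬ (w a < w c ∧ w c < w b) := by
  constructor
  · intro h
    have hlt : w a < w b := (inv_lt_inv_mul_swap_iff w hab).mp (by omega)
    refine ⟨hlt, fun c hac hcb hc => ?_⟩
    -- An intermediate value at `c` makes each step of t_{a,b} = t_{a,c} t_{c,b} t_{a,c} add
    -- inversions, so at least three are gained.
    have h1 := inv_lt_inv_mul_swap w hac hc.1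
    have h2 := inv_lt_inv_mul_swap (w * swap a c) hcb (by
      rw [Perm.mul_apply, Perm.mul_apply, swap_apply_right,
        swap_apply_of_ne_of_ne hab.ne' hcb.ne']
      exact hlt)
    have h3 := inv_lt_inv_mul_swap (w * swap a c * swap c b) hac (by
      rw [Perm.mul_apply, Perm.mul_apply, Perm.mul_apply, Perm.mul_apply, swap_apply_left,
        swap_apply_of_ne_of_ne hac.ne hab.ne, swap_apply_left,
        swap_apply_of_ne_of_ne hab.ne' hcb.ne']
      exact hc.2)
    have h4 : w * swap a c * swap c b * swap a c = w * swap a b := by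
      rw [mul_assoc w, mul_assoc w, swap_comm a c, swap_comm c b,
        swap_mul_swap_mul_swap hcb.ne' hab.ne']
    rw [h4] at h3
    omega
  · rintro ⟨h1, h2⟩
    have h3 := inv_lt_inv_mul_swap w hab h1
    have h4 := inv_mul_swap_le w hab h2
    omega

/-! ### Length and reduced words -/

theorem inv_wordProd_le {n : ℕ} (a : List (Fin (n - 1))) : inv (wordProd a) ≤ a.length := by
  induction a with
  | nil => simp [wordProd, inv_one]
  | cons i a ih =>
    have hc : wordProd (i :: a) = simpleTransposition i * wordProd a := by simp [wordProd]
    rw [hc, List.length_cons]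
    rcases inv_simpleTransposition_mul i (wordProd a) with h | h <;> omega

/-- Without a descent the inverse of `w` is increasing, hence the identity. -/
theorem exists_inv_descent {n : ℕ} (w : Perm (Fin n)) (hw : w ≠ 1) :
    ∃ i : Fin (n - 1), inv w = inv (simpleTransposition i * w) + 1 := by
  by_contra hcon
  push Not at hcon
  apply hw
  have hmono : StrictMono w.symm := by
    obtain _ | n := n
    · exact fun a => a.elim0
    · rw [Fin.strictMono_iff_lt_succ]
      intro i
      by_contra hn
      have hne : w.symm i.castSucc ≠ w.symm i.succ :=
        fun he => (Fin.castSucc_lt_succ (i := i)).ne (w.symm.injective he)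
      exact hcon i (inv_simpleTransposition_mul_of_gt (n := n + 1) i w (a := w.symm i.castSucc)
        (b := w.symm i.succ) (by simp) (by simp) (lt_of_le_of_ne (not_lt.mp hn) hne.symm))
  have h1 : ∀ x, w.symm x = x := fun x => by
    have := Subsingleton.elim (hmono.orderIsoOfSurjective _ w.symm.surjective) (OrderIso.refl _)
    exact DFunLike.congr_fun this x
  ext x
  rw [← h1 (w x)]
  simp

theorem exists_wordProd {n : ℕ} (w : Perm (Fin n)) :
    ∃ a : List (Fin (n - 1)), wordProd a = w ∧ a.length = inv w := by
  induction hk : inv w using Nat.strong_induction_on generalizing w with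
  | _ k ih =>
    by_cases hw : w = 1
    · subst hw
      exact ⟨[], by simp [wordProd], by rw [← hk, inv_one]; rfl⟩
    · obtain ⟨i, hi⟩ := exists_inv_descent w hw
      obtain ⟨a, ha, hl⟩ := ih _ (by omega) (simpleTransposition i * w) rfl
      refine ⟨i :: a, ?_, by rw [List.length_cons]; omega⟩
      have hc : wordProd (i :: a) = simpleTransposition i * wordProd a := by simp [wordProd]
      rw [hc, ha, simpleTransposition_mul_cancel]

theorem length_eq_inv {n : ℕ} (w : Perm (Fin n)) : length w = inv w := by
  apply le_antisymm
  · exact Nat.sInf_le (exists_wordProd w)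
  · refine le_csInf ⟨_, exists_wordProd w⟩ ?_
    rintro m ⟨a, rfl, rfl⟩
    exact inv_wordProd_le a

theorem isReducedWord_iff {n : ℕ} (w : Perm (Fin n)) (a : List (Fin (n - 1))) :
    IsReducedWord w a ↔ wordProd a = w ∧ a.length = inv w := by
  constructor
  · rintro ⟨h, hmin⟩
    obtain ⟨b, hb, hbl⟩ := exists_wordProd w
    have h1 := hmin b hb
    have h2 := inv_wordProd_le a
    rw [h] at h2
    exact ⟨h, by omega⟩
  · rintro ⟨h, hl⟩
    refine ⟨h, fun b hb => ?_⟩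
    rw [hl, ← hb]
    exact inv_wordProd_le b

/-- This recursion on the first letter is the one that `nilMul` encodes. -/
theorem isReducedWord_cons {n : ℕ} (w : Perm (Fin n)) (i : Fin (n - 1)) (a : List (Fin (n - 1))) :
    IsReducedWord w (i :: a) ↔
      inv (simpleTransposition i * w) < inv w ∧ IsReducedWord (simpleTransposition i * w) a := by
  have hc : wordProd (i :: a) = simpleTransposition i * wordProd a := by simp [wordProd]
  have he : wordProd (i :: a) = w ↔ wordProd a = simpleTransposition i * w := by
    rw [hc]
    constructor
    · rintro rfl
      rw [simpleTransposition_mul_cancel]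
    · intro h
      rw [h, simpleTransposition_mul_cancel]
  rw [isReducedWord_iff, isReducedWord_iff, he, List.length_cons]
  constructor
  · rintro ⟨h1, h2⟩
    have h3 := inv_wordProd_le a
    rw [h1] at h3
    rcases inv_simpleTransposition_mul i w with h | h
    · omega
    · exact ⟨by omega, h1, by omega⟩
  · rintro ⟨h, h1, h2⟩
    refine ⟨h1, ?_⟩
    rcases inv_simpleTransposition_mul i w with h | h <;> omega

/-! ### The cover operator on the nil-Coxeter algebra -/

variable {n : ℕ} {R : Type*} [CommRing R]

/-- Left multiplication by the generator `u_i` of the nil-Coxeter algebra, on the functions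
`f : S_n → R` that stand for `∑ f(w) u_w`. -/
def nilMul (i : Fin (n - 1)) (f : Perm (Fin n) → R) (w : Perm (Fin n)) : R :=
  if inv (simpleTransposition i * w) < inv w then f (simpleTransposition i * w) else 0

/-- The signed sum of the values of `f` at the Bruhat covers `v t_{j,k}` of `v`, positive for
`j < k` and negative for `j > k`. -/
def coverSum (k : Fin n) (f : Perm (Fin n) → R) (v : Perm (Fin n)) : R :=
  ∑ j, if inv (v * swap j k) = inv v + 1 then
    (if j < k then f (v * swap j k) else - f (v * swap j k)) else 0

theorem coverSum_add (k : Fin n) (f g : Perm (Fin n) → R) (v : Perm (Fin n)) :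
    coverSum k (fun w => f w + g w) v = coverSum k f v + coverSum k g v := by
  rw [coverSum, coverSum, coverSum, ← Finset.sum_add_distrib]
  refine Finset.sum_congr rfl fun j _ => ?_
  split_ifs <;> ring

theorem coverSum_mul_left (k : Fin n) (x : R) (f : Perm (Fin n) → R) (v : Perm (Fin n)) :
    coverSum k (fun w => x * f w) v = x * coverSum k f v := by
  rw [coverSum, coverSum, Finset.mul_sum]
  refine Finset.sum_congr rfl fun j _ => ?_
  split_ifs <;> ring

/-- Left multiplication by s_i reverses the order of two entries only if they are `i` and `i + 1`,
which the hypothesis excludes. -/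
theorem inv_lt_inv_mul_swap_iff_of_ne (i : Fin (n - 1)) (v : Perm (Fin n)) {a b : Fin n}
    (h : simpleTransposition i * v * swap a b ≠ v) :
    inv (simpleTransposition i * v) < inv (simpleTransposition i * v * swap a b) ↔
      inv v < inv (v * swap a b) := by
  wlog hab : a < b generalizing a b
  · rcases (not_lt.mp hab).eq_or_lt with rfl | hlt
    · rw [swap_self, ← Perm.one_def, mul_one, mul_one]
      simp
    · rw [swap_comm] at h ⊢
      exact this h hlt
  rw [inv_lt_inv_mul_swap_iff _ hab, inv_lt_inv_mul_swap_iff _ hab, Perm.mul_apply,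
    Perm.mul_apply]
  have key : ∀ c d : Fin n, simpleTransposition i * v * swap c d ≠ v →
      ¬ ((v c : ℕ) = i ∧ (v d : ℕ) = i + 1) := by
    rintro c d hcd ⟨hc, hd⟩
    apply hcd
    have hs : simpleTransposition i = swap (v c) (v d) := by
      rw [simpleTransposition]
      congr 1 <;> exact Fin.ext (by simp [hc, hd])
    rw [hs, ← mul_swap_eq_swap_mul, mul_assoc, swap_mul_self, mul_one]
  exact simpleTransposition_lt_iff i (key a b h) (key b a (by rwa [swap_comm]))

/-- The conditions under which `v t_{a,b}` covers `v` and descends along `s_i`, and under which `v`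
descends along `s_i` to a permutation covered by `s_i v t_{a,b}`, agree unless `s_i v = v t_{a,b}`.
-/
theorem cover_descent_iff (i : Fin (n - 1)) (v : Perm (Fin n)) {a b : Fin n}
    (h : simpleTransposition i * v * swap a b ≠ v) :
    (inv (v * swap a b) = inv v + 1 ∧
        inv (simpleTransposition i * (v * swap a b)) < inv (v * swap a b)) ↔
      (inv (simpleTransposition i * v) < inv v ∧
        inv (simpleTransposition i * v * swap a b) = inv (simpleTransposition i * v) + 1) := by
  have h1 := inv_lt_inv_mul_swap_iff_of_ne i v h
  have h2 := inv_simpleTransposition_mul i v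
  have h3 := inv_simpleTransposition_mul i (v * swap a b)
  rw [← mul_assoc] at h3 ⊢
  -- Both changes by s_i are ±1 and `h1` compares the two pairs of lengths; the rest is arithmetic.
  omega

/-- Terms match one by one unless t_{j,k} exchanges the positions of the values `i` and `i + 1`.
There only one side contributes, depending on whether s_i v is longer or shorter than v; with the
sign of `coverSum`, the correction is the same in both cases. -/
theorem coverSum_nilMul (k : Fin n) (i : Fin (n - 1)) (f : Perm (Fin n) → R) (v : Perm (Fin n)) :
    coverSum k (nilMul i f) v = nilMul i (coverSum k f) v +
      ((if (v k : ℕ) = i + 1 then f v else 0) - if (v k : ℕ) = i then f v else 0) := by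
  obtain ⟨a, b, ha, hb, hab⟩ := exists_consecutive_values i v
  have hs : simpleTransposition i = swap (v a) (v b) := by
    rw [simpleTransposition]
    congr 1 <;> exact Fin.ext (by simp [ha, hb])
  have hsv : simpleTransposition i * v = v * swap a b := by
    rw [hs, ← mul_swap_eq_swap_mul]
  have hk1 : (v k : ℕ) = i + 1 ↔ k = b := by
    rw [← hb, ← Fin.ext_iff, v.injective.eq_iff]
  have hk0 : (v k : ℕ) = i ↔ k = a := by
    rw [← ha, ← Fin.ext_iff, v.injective.eq_iff]
  have hpair : ∀ j, simpleTransposition i * v * swap j k = v ↔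
      (j = a ∧ k = b) ∨ (j = b ∧ k = a) := by
    intro j
    rw [hsv, mul_assoc, mul_eq_left, mul_eq_one_iff_eq_inv, swap_inv]
    constructor
    · intro h
      have h1 := DFunLike.congr_fun h a
      rw [swap_apply_left, swap_apply_def] at h1
      split_ifs at h1 with h2 h3
      · exact Or.inl ⟨h2.symm, h1.symm⟩
      · exact Or.inr ⟨h1.symm, h3.symm⟩
      · exact absurd h1.symm hab
    · rintro (⟨rfl, rfl⟩ | ⟨rfl, rfl⟩)
      · rfl
      · exact swap_comm _ _
  have hdesc : inv (simpleTransposition i * v) < inv v ↔ b < a := by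
    rcases lt_or_gt_of_ne hab with h | h
    · have := inv_simpleTransposition_mul_of_lt i v ha hb h
      simp only [h.not_gt, iff_false]; omega
    · have := inv_simpleTransposition_mul_of_gt i v ha hb h
      simp only [h, iff_true]; omega
  have h2 := inv_simpleTransposition_mul i v
  simp only [hk1, hk0]
  have hterm : ∀ j, (if inv (v * swap j k) = inv v + 1 then
      (if j < k then nilMul i f (v * swap j k) else - nilMul i f (v * swap j k)) else 0) =
      (if inv (simpleTransposition i * v) < inv v then
        (if inv (simpleTransposition i * v * swap j k) = inv (simpleTransposition i * v) + 1 then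
          (if j < k then f (simpleTransposition i * v * swap j k)
            else - f (simpleTransposition i * v * swap j k)) else 0) else 0) +
      ((if j = a then (if k = b then f v else 0) else 0) -
        (if j = b then (if k = a then f v else 0) else 0)) := by
    intro j
    by_cases hj : simpleTransposition i * v * swap j k = v
    · have hj' : simpleTransposition i * (v * swap j k) = v := by rw [← mul_assoc, hj]
      have hvj : v * swap j k = simpleTransposition i * v := by
        rw [← simpleTransposition_mul_cancel i (v * swap j k), hj']
      simp only [nilMul, hj, hvj, simpleTransposition_mul_cancel]
      rcases (hpair j).mp hj with ⟨rfl, rfl⟩ | ⟨rfl, rfl⟩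
      · rcases lt_or_gt_of_ne hab with h | h
        · have hd : ¬ inv (simpleTransposition i * v) < inv v := by rw [hdesc]; exact h.not_gt
          rw [if_pos (by omega), if_pos h, if_pos (by omega), if_neg hd]
          simp [hab]
        · have hd : inv (simpleTransposition i * v) < inv v := by rw [hdesc]; exact h
          rw [if_neg (by omega), if_pos hd, if_pos (by omega), if_neg h.not_gt]
          simp [hab]
      · rcases lt_or_gt_of_ne hab with h | h
        · have hd : ¬ inv (simpleTransposition i * v) < inv v := by rw [hdesc]; exact h.not_gt
          rw [if_pos (by omega), if_neg h.not_gt, if_pos (by omega), if_neg hd]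
          simp [hab.symm]
        · have hd : inv (simpleTransposition i * v) < inv v := by rw [hdesc]; exact h
          rw [if_neg (by omega), if_pos hd, if_pos (by omega), if_pos h]
          simp [hab.symm]
    · have hno := (hpair j).not.mp hj
      have hz : ((if j = a then (if k = b then f v else 0) else 0) -
        (if j = b then (if k = a then f v else 0) else 0)) = 0 := by
        rw [← ite_and, ← ite_and, if_neg fun h => hno (Or.inl h), if_neg fun h => hno (Or.inr h),
          sub_zero]
      rw [hz, add_zero]
      have hiff := cover_descent_iff i v hj
      simp only [nilMul]
      by_cases hl : inv (simpleTransposition i * v) < inv v ∧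
        inv (simpleTransposition i * v * swap j k) = inv (simpleTransposition i * v) + 1
      · have hl' := hiff.mpr hl
        rw [if_pos hl.1, if_pos hl.2, if_pos hl'.1, if_pos hl'.2, mul_assoc]
      · have hl' := fun h => hl (hiff.mp h)
        rw [← ite_and, if_neg hl]
        by_cases h3 : inv (v * swap j k) = inv v + 1
        · rw [if_pos h3, if_neg fun h4 => hl' ⟨h3, h4⟩]
          simp
        · rw [if_neg h3]
  rw [coverSum, Finset.sum_congr rfl fun j _ => hterm j, Finset.sum_add_distrib,
    Finset.sum_sub_distrib, Finset.sum_ite_eq', Finset.sum_ite_eq']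
  simp only [Finset.mem_univ, if_true]
  congr 1
  rw [nilMul, coverSum]
  split_ifs
  · rfl
  · exact Finset.sum_const_zero

/-! ### Extremal positions and telescoping along a row -/

/-- The entry of `v` at `k` is the smallest up to `k`, or the largest from `k` on. -/
def IsExtremal (k : Fin n) (v : Perm (Fin n)) : Prop :=
  (∀ j, k < j → v j < v k) ∨ ∀ i, i < k → v k < v i

/-- Extremality asks certain pairs of positions to be inversions, and inversions of the shorter s_i
v remain inversions of v. -/
theorem isExtremal_of_simpleTransposition_mul {k : Fin n} {v : Perm (Fin n)} {i : Fin (n - 1)}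
    (hd : inv (simpleTransposition i * v) < inv v)
    (h : IsExtremal k (simpleTransposition i * v)) : IsExtremal k v := by
  have key : ∀ {x y : Fin n}, x < y →
      (simpleTransposition i * v) y < (simpleTransposition i * v) x → v y < v x := by
    intro x y hxy hlt
    by_cases h2 : (v x : ℕ) = i ∧ (v y : ℕ) = i + 1
    · have := inv_simpleTransposition_mul_of_lt i v h2.1 h2.2 hxy
      omega
    by_cases h1 : (v y : ℕ) = i ∧ (v x : ℕ) = i + 1
    · rw [Fin.lt_def]; omega
    · exact (simpleTransposition_lt_iff i h1 h2).mp hlt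
  exact h.imp (fun h j hj => key hj (h j hj)) fun h j hj => key hj (h j hj)

/-- Left multiplication by `1 + x u_i`. -/
def factorMul (x : R) (i : Fin (n - 1)) (f : Perm (Fin n) → R) (w : Perm (Fin n)) : R :=
  f w + x * nilMul i f w

theorem coverSum_factorMul (k : Fin n) (x : R) (i : Fin (n - 1)) (f : Perm (Fin n) → R)
    (v : Perm (Fin n)) :
    coverSum k (factorMul x i f) v = factorMul x i (coverSum k f) v +
      x * ((if (v k : ℕ) = i + 1 then f v else 0) - if (v k : ℕ) = i then f v else 0) := by
  unfold factorMul
  rw [coverSum_add, coverSum_mul_left, coverSum_nilMul]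
  ring

/-- Left multiplication by `(1 + x u_{j-1}) ⋯ (1 + x u_1) (1 + x u_0)`. -/
def rowMul (x : R) (f : Perm (Fin n) → R) : (j : ℕ) → j ≤ n - 1 → Perm (Fin n) → R
  | 0, _ => f
  | j + 1, h => factorMul x ⟨j, h⟩ (rowMul x f j (by omega))

/-- The error of the factor `1 + x u_j` cancels the boundary term at value `j` and creates the one
at `j + 1`. -/
theorem coverSum_rowMul (x : R) (f : Perm (Fin n) → R) (k : Fin n)
    (hf : ∀ v, ¬ IsExtremal k v → coverSum k f v = 0) (j : ℕ) (hj : j ≤ n - 1)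
    (v : Perm (Fin n)) (hv : ¬ IsExtremal k v) :
    coverSum k (rowMul x f j hj) v = if (v k : ℕ) = j then x * rowMul x f j hj v else 0 := by
  induction j generalizing v with
  | zero =>
    -- The boundary term at value `0` is absent because the least value is extremal.
    have h0 : (v k : ℕ) ≠ 0 := by
      intro h0
      refine hv (Or.inr fun i hi => ?_)
      have : v i ≠ v k := fun he => hi.ne (v.injective he)
      rw [Fin.lt_def]
      rw [Ne, Fin.ext_iff] at this
      omega
    rw [if_neg h0]
    exact hf v hv
  | succ j ih =>
    rw [rowMul, coverSum_factorMul]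
    set g := rowMul x f j (by omega) with hg
    set i : Fin (n - 1) := ⟨j, hj⟩ with hi
    have hij : (i : ℕ) = j := rfl
    have hnil : nilMul i (coverSum k g) v = if (v k : ℕ) = j + 1 then x * nilMul i g v else 0 := by
      simp only [nilMul]
      by_cases hd : inv (simpleTransposition i * v) < inv v
      · rw [if_pos hd, if_pos hd, ih (by omega) _
          fun h => hv (isExtremal_of_simpleTransposition_mul hd h)]
        have : ((simpleTransposition i * v) k : ℕ) = j ↔ (v k : ℕ) = j + 1 := by
          rw [Perm.mul_apply, simpleTransposition_val, hij]
          split_ifs <;> omega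
        simp only [this, hg]
      · simp [hd]
    rw [factorMul, ih (by omega) v hv, hnil, factorMul, hij]
    by_cases h1 : (v k : ℕ) = j
    · simp [h1, hg]
    · by_cases h2 : (v k : ℕ) = j + 1
      · simp [h2]; ring
      · simp [h1, h2]

theorem coverSum_rowMul_eq_zero (x : R) (f : Perm (Fin n) → R) (k : Fin n)
    (hf : ∀ v, ¬ IsExtremal k v → coverSum k f v = 0)
    (v : Perm (Fin n)) (hv : ¬ IsExtremal k v) :
    coverSum k (rowMul x f (n - 1) le_rfl) v = 0 := by
  rw [coverSum_rowMul x f k hf _ _ v hv, if_neg]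
  intro h
  -- The surviving boundary term sits at the greatest value `n - 1`, again extremal.
  refine hv (Or.inl fun j hj => ?_)
  have : v j ≠ v k := fun he => hj.ne' (v.injective he)
  rw [Fin.lt_def]
  rw [Ne, Fin.ext_iff] at this
  omega

theorem coverSum_single_one (k : Fin n) (v : Perm (Fin n)) :
    coverSum k (Pi.single 1 (1 : R)) v = 0 := by
  refine Finset.sum_eq_zero fun j _ => ?_
  by_cases h : inv (v * swap j k) = inv v + 1
  · have hne : v * swap j k ≠ 1 := by
      intro he
      rw [he, inv_one] at h
      omega
    simp [hne]
  · rw [if_neg h]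

/-! ### Stanley functions as coefficients of a product -/

/-- The coefficients `w ↦ ∑ x_{b_1} ⋯ x_{b_ℓ}` of the product of the factors `1 + x_b u_a`, taken
along a list of pairs `(a, b)`. -/
noncomputable def factorProd (L : List (Fin (n - 1) × ℕ)) : Perm (Fin n) → MvPolynomial ℕ ℤ :=
  L.foldr (fun c f => factorMul (MvPolynomial.X c.2) c.1 f) (Pi.single 1 1)

/-- The sublists of `L` whose first components form a reduced word of `w`, and whose second
components have exponent `m`. -/
def reducedSublists (L : List (Fin (n - 1) × ℕ)) (w : Perm (Fin n)) (m : ℕ →₀ ℕ) :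
    Set (List (Fin (n - 1) × ℕ)) :=
  {c | c.Sublist L ∧ IsReducedWord w (c.map Prod.fst) ∧
    Multiset.toFinsupp (c.map Prod.snd : Multiset ℕ) = m}

theorem reducedSublists_finite (L : List (Fin (n - 1) × ℕ)) (w : Perm (Fin n)) (m : ℕ →₀ ℕ) :
    (reducedSublists L w m).Finite := by
  refine (L.sublists.toFinset.finite_toSet).subset fun c hc => ?_
  simpa using hc.1

theorem isReducedWord_nil (w : Perm (Fin n)) : IsReducedWord w [] ↔ w = 1 := by
  rw [isReducedWord_iff]
  constructor
  · rintro ⟨h, -⟩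
    simpa [wordProd] using h.symm
  · rintro rfl
    exact ⟨by simp [wordProd], by rw [inv_one]; rfl⟩

theorem toFinsupp_cons_eq_iff (b : ℕ) (s : Multiset ℕ) (m : ℕ →₀ ℕ) :
    Multiset.toFinsupp (b ::ₘ s) = m ↔
      b ∈ m.support ∧ Multiset.toFinsupp s = m - Finsupp.single b 1 := by
  rw [← Multiset.singleton_add, map_add, Multiset.toFinsupp_singleton]
  constructor
  · rintro rfl
    simp
  · rintro ⟨hb, h⟩
    rw [h, add_tsub_cancel_of_le]
    rw [Finsupp.single_le_iff]
    exact Nat.one_le_iff_ne_zero.mpr (Finsupp.mem_support_iff.mp hb)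

/-- The two terms of `factorMul` correspond to skipping or using the head letter; `Nodup` makes
these cases disjoint. -/
theorem coeff_factorProd (L : List (Fin (n - 1) × ℕ)) (hL : L.Nodup) (w : Perm (Fin n))
    (m : ℕ →₀ ℕ) :
    MvPolynomial.coeff m (factorProd L w) = ((reducedSublists L w m).ncard : ℤ) := by
  induction L generalizing w m with
  | nil =>
    have hS : reducedSublists ([] : List (Fin (n - 1) × ℕ)) w m =
        if w = 1 ∧ m = 0 then {[]} else ∅ := by
      ext c
      simp only [reducedSublists, Set.mem_ofPred_eq, List.sublist_nil]
      split_ifs with h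
      · obtain ⟨rfl, rfl⟩ := h
        simp only [Set.mem_singleton_iff]
        refine ⟨fun h => h.1, ?_⟩
        rintro rfl
        exact ⟨rfl, (isReducedWord_nil _).mpr rfl, by simp⟩
      · simp only [Set.mem_empty_iff_false, iff_false]
        rintro ⟨rfl, h1, h2⟩
        exact h ⟨(isReducedWord_nil _).mp h1, by simpa using h2.symm⟩
    rw [hS, factorProd, List.foldr_nil]
    by_cases hw : w = 1
    · subst hw
      rw [Pi.single_eq_same, MvPolynomial.coeff_one]
      by_cases hm : m = 0
      · simp [hm]
      · simp [hm, Ne.symm hm]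
    · simp [hw]
  | cons x L ih =>
    obtain ⟨a, b⟩ := x
    rw [List.nodup_cons] at hL
    have hS : reducedSublists ((a, b) :: L) w m = reducedSublists L w m ∪
        (if inv (simpleTransposition a * w) < inv w ∧ b ∈ m.support then
          List.cons (a, b) '' reducedSublists L (simpleTransposition a * w)
            (m - Finsupp.single b 1) else ∅) := by
      ext c
      simp only [reducedSublists, Set.mem_union, Set.mem_ofPred_eq, List.sublist_cons_iff]
      constructor
      · rintro ⟨h | ⟨c, rfl, h⟩, hw, hm⟩
        · exact Or.inl ⟨h, hw, hm⟩
        · right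
          rw [List.map_cons, isReducedWord_cons] at hw
          rw [List.map_cons, ← Multiset.cons_coe, toFinsupp_cons_eq_iff] at hm
          rw [if_pos ⟨hw.1, hm.1⟩]
          exact ⟨c, ⟨h, hw.2, hm.2⟩, rfl⟩
      · rintro (⟨h, hw, hm⟩ | h)
        · exact ⟨Or.inl h, hw, hm⟩
        · split_ifs at h with hc
          · obtain ⟨c, ⟨h, hw, hm⟩, rfl⟩ := h
            refine ⟨Or.inr ⟨c, rfl, h⟩, ?_, ?_⟩
            · rw [List.map_cons, isReducedWord_cons]
              exact ⟨hc.1, hw⟩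
            · rw [List.map_cons, ← Multiset.cons_coe, toFinsupp_cons_eq_iff]
              exact ⟨hc.2, hm⟩
          · exact h.elim
    have hrec : factorProd ((a, b) :: L) w =
        factorProd L w + MvPolynomial.X b * nilMul a (factorProd L) w := rfl
    rw [hS, hrec, MvPolynomial.coeff_add, ih hL.2, MvPolynomial.coeff_X_mul', nilMul]
    by_cases hc : inv (simpleTransposition a * w) < inv w ∧ b ∈ m.support
    · rw [if_pos hc, if_pos hc.2, if_pos hc.1, ih hL.2, Set.ncard_union_eq ?_
        (reducedSublists_finite _ _ _) ((reducedSublists_finite _ _ _).image _),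
        Set.ncard_image_of_injective _ List.cons_injective, Nat.cast_add]
      rw [Set.disjoint_left]
      rintro _ hc ⟨c, -, rfl⟩
      exact hL.1 (hc.1.subset List.mem_cons_self)
    · rw [if_neg hc, Set.union_empty]
      by_cases h1 : inv (simpleTransposition a * w) < inv w
      · rw [if_neg fun h2 => hc ⟨h1, h2⟩, add_zero]
      · simp [h1]

/-- The pairs `(j - 1, b), …, (0, b)`. -/
def rowLetters (b : ℕ) : (j : ℕ) → j ≤ n - 1 → List (Fin (n - 1) × ℕ)
  | 0, _ => []
  | j + 1, h => (⟨j, h⟩, b) :: rowLetters b j (by omega)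

theorem mem_rowLetters {b j : ℕ} {hj : j ≤ n - 1} {c : Fin (n - 1) × ℕ} :
    c ∈ rowLetters b j hj ↔ (c.1 : ℕ) < j ∧ c.2 = b := by
  induction j with
  | zero => simp [rowLetters]
  | succ j ih =>
    rw [rowLetters, List.mem_cons, ih, Prod.ext_iff, Fin.ext_iff]
    simp only
    omega

/-- The strict order on pairs in which a compatible pair of sequences increases: the second
components increase, and the first components decrease where the second ones agree. -/
def LetterLT (c d : Fin (n - 1) × ℕ) : Prop :=
  c.2 < d.2 ∨ c.2 = d.2 ∧ d.1 < c.1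

instance : IsTrans (Fin (n - 1) × ℕ) LetterLT where
  trans a b c := by
    unfold LetterLT
    rw [Fin.lt_def, Fin.lt_def, Fin.lt_def]
    omega

instance : Std.Irrefl (LetterLT (n := n)) where
  irrefl a := by
    unfold LetterLT
    rw [Fin.lt_def]
    omega

instance : Std.Antisymm (LetterLT (n := n)) where
  antisymm a b := by
    unfold LetterLT
    rw [Fin.lt_def, Fin.lt_def]
    omega

theorem pairwise_rowLetters (b j : ℕ) (hj : j ≤ n - 1) :
    (rowLetters b j hj).Pairwise LetterLT := by
  induction j with
  | zero => exact List.Pairwise.nil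
  | succ j ih =>
    refine List.Pairwise.cons (fun c hc => ?_) (ih _)
    rw [mem_rowLetters] at hc
    exact Or.inr ⟨hc.2.symm, hc.1⟩

/-- The pairs with second component `b, …, b + M - 1`, in increasing order. -/
def letters (n : ℕ) : ℕ → ℕ → List (Fin (n - 1) × ℕ)
  | _, 0 => []
  | b, M + 1 => rowLetters b (n - 1) le_rfl ++ letters n (b + 1) M

theorem mem_letters {b M : ℕ} {c : Fin (n - 1) × ℕ} :
    c ∈ letters n b M ↔ b ≤ c.2 ∧ c.2 < b + M := by
  induction M generalizing b with
  | zero => simp [letters]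
  | succ M ih =>
    rw [letters, List.mem_append, ih, mem_rowLetters]
    have := c.1.2
    omega

theorem pairwise_letters (b M : ℕ) : (letters n b M).Pairwise LetterLT := by
  induction M generalizing b with
  | zero => exact List.Pairwise.nil
  | succ M ih =>
    rw [letters, List.pairwise_append]
    refine ⟨pairwise_rowLetters _ _ _, ih _, fun c hc d hd => Or.inl ?_⟩
    rw [mem_rowLetters] at hc
    rw [mem_letters] at hd
    omega

theorem factorProd_rowLetters_append (b j : ℕ) (hj : j ≤ n - 1) (L : List (Fin (n - 1) × ℕ)) :
    factorProd (rowLetters b j hj ++ L) =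
      rowMul (MvPolynomial.X b) (factorProd L) j hj := by
  induction j with
  | zero => rfl
  | succ j ih =>
    rw [rowMul, ← ih]
    rfl

theorem coverSum_factorProd_letters (b M : ℕ) (k : Fin n) (v : Perm (Fin n))
    (hv : ¬ IsExtremal k v) : coverSum k (factorProd (letters n b M)) v = 0 := by
  induction M generalizing b v with
  | zero => exact coverSum_single_one k v
  | succ M ih =>
    rw [letters, factorProd_rowLetters_append]
    exact coverSum_rowMul_eq_zero _ _ k (fun u hu => ih _ u hu) v hv

/-- A reduced word has no two equal adjacent letters, so equal second components force a strict
decrease of the first. -/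
theorem isChain_letterLT {w : Perm (Fin n)} {c : List (Fin (n - 1) × ℕ)}
    (hw : IsReducedWord w (c.map Prod.fst))
    (hc : c.IsChain (fun x y => x.2 ≤ y.2 ∧ (x.1 < y.1 → x.2 < y.2))) :
    c.IsChain LetterLT := by
  induction c generalizing w with
  | nil => exact List.isChain_nil
  | cons x c ih =>
    rw [List.map_cons, isReducedWord_cons] at hw
    cases c with
    | nil => exact List.isChain_singleton _
    | cons y c =>
      rw [List.isChain_cons_cons] at hc ⊢
      refine ⟨?_, ih hw.2 hc.2⟩
      have hne : x.1 ≠ y.1 := by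
        intro he
        have h2 := hw.2
        rw [List.map_cons, isReducedWord_cons, ← he, simpleTransposition_mul_cancel] at h2
        exact lt_asymm hw.1 h2.1
      have h3 := hc.1
      unfold LetterLT
      rw [Ne, Fin.ext_iff] at hne
      rw [Fin.lt_def] at h3 ⊢
      omega

/-- `letters n 0 M` lists all pairs with second component below `M` in increasing order, so its
sublists are exactly the increasing lists of such pairs. -/
theorem compatiblePairs_eq_reducedSublists (w : Perm (Fin n)) (m : ℕ →₀ ℕ) {M : ℕ}
    (hM : ∀ b ∈ m.support, b < M) :
    compatiblePairs w m = reducedSublists (letters n 0 M) w m := by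
  ext c
  constructor
  · rintro ⟨hw, hc, hm⟩
    refine ⟨?_, hw, hm⟩
    have hp : c.Pairwise LetterLT := (isChain_letterLT hw hc).pairwise
    refine List.sublist_of_subperm_of_pairwise (List.subperm_of_subset hp.nodup ?_) hp
      (pairwise_letters 0 M)
    intro x hx
    rw [mem_letters]
    refine ⟨Nat.zero_le _, ?_⟩
    rw [zero_add]
    apply hM
    rw [← hm]
    simpa using ⟨x.1, hx⟩
  · rintro ⟨hs, hw, hm⟩
    refine ⟨hw, ?_, hm⟩
    refine ((pairwise_letters 0 M).sublist hs).isChain.imp fun x y h => ?_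
    unfold LetterLT at h
    rw [Fin.lt_def] at h ⊢
    omega

/-- The bound `M` depends on `m` alone, so one product serves all covers at once. -/
theorem exists_coeff_stanley_eq (m : ℕ →₀ ℕ) :
    ∃ M : ℕ, ∀ w : Perm (Fin n),
      stanley w m = MvPolynomial.coeff m (factorProd (letters n 0 M) w) := by
  refine ⟨m.support.sup id + 1, fun w => ?_⟩
  rw [coeff_factorProd _ (pairwise_letters _ _).nodup, stanley,
    compatiblePairs_eq_reducedSublists w m fun b hb => ?_]
  exact Nat.lt_succ_of_le (Finset.le_sup (f := id) hb)

/-! ### The transition formula -/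

/-- The transition formula, at a position whose entry is neither the smallest up to that position
nor the largest from it on. -/
theorem sum_covers_left_eq_sum_covers_right (k : Fin n) (v : Perm (Fin n))
    (hv : ¬ IsExtremal k v) :
    ∑ i with i < k ∧ inv (v * swap i k) = inv v + 1, stanley (v * swap i k) =
      ∑ j with k < j ∧ inv (v * swap j k) = inv v + 1, stanley (v * swap j k) := by
  rw [← sub_eq_zero]
  refine MvPowerSeries.ext fun m => ?_
  obtain ⟨M, hM⟩ := exists_coeff_stanley_eq (n := n) m
  have h := congrArg (MvPolynomial.coeff m) (coverSum_factorProd_letters 0 M k v hv)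
  rw [map_sub, map_sum, map_sum, map_zero]
  rw [coverSum, MvPolynomial.coeff_sum, MvPolynomial.coeff_zero] at h
  rw [← h, Finset.sum_filter, Finset.sum_filter, ← Finset.sum_sub_distrib]
  refine Finset.sum_congr rfl fun j _ => ?_
  have hj : MvPowerSeries.coeff m (stanley (v * swap j k)) =
    MvPolynomial.coeff m (factorProd (letters n 0 M) (v * swap j k)) := hM _
  rw [hj]
  by_cases hc : inv (v * swap j k) = inv v + 1
  · rcases lt_trichotomy j k with h | h | h
    · simp [hc, h, h.not_gt]
    · subst h
      rw [swap_self, ← Perm.one_def, mul_one] at hc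
      omega
    · simp [hc, h, h.not_gt]
  · simp [hc]

/-! ### The choice of p and q -/

theorem pIndex_spec (w : Perm (Fin n)) (hw : ¬ IsDominant w) {i t j : Fin n} (hit : i < t)
    (htj : t < j) (hij : w i < w j) (hjt : w j < w t) : t ≤ pIndex w hw :=
  Finset.le_max' _ _ (Finset.mem_filter.mpr ⟨Finset.mem_univ _, i, j, hit, htj, hij, hjt⟩)

theorem qIndex_mem (w : Perm (Fin n)) (hw : ¬ IsDominant w) :
    pIndex w hw < qIndex w hw ∧ w (qIndex w hw) < w (pIndex w hw) ∧
      ∃ i, i < pIndex w hw ∧ w i < w (qIndex w hw) :=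
  (Finset.mem_filter.mp (Finset.max'_mem _ (lastPositions_nonempty hw))).2

theorem le_qIndex (w : Perm (Fin n)) (hw : ¬ IsDominant w) {i j : Fin n} (hj : pIndex w hw < j)
    (hjp : w j < w (pIndex w hw)) (hi : i < pIndex w hw) (hij : w i < w j) : j ≤ qIndex w hw :=
  Finset.le_max' _ _ (Finset.mem_filter.mpr ⟨Finset.mem_univ _, hj, hjp, i, hi, hij⟩)

theorem covers_right_pIndex (w : Perm (Fin n)) (hw : ¬ IsDominant w) (j : Fin n) :
    (pIndex w hw < j ∧ inv (w * swap (pIndex w hw) (qIndex w hw) * swap j (pIndex w hw)) =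
      inv (w * swap (pIndex w hw) (qIndex w hw)) + 1) ↔ j = qIndex w hw := by
  obtain ⟨hpq, hqp, i, hi, hiq⟩ := qIndex_mem w hw
  -- Otherwise `i`, `c`, `q` form a 132 pattern whose middle lies beyond p.
  have hmid : ∀ c, pIndex w hw < c → c < qIndex w hw → ¬ w (qIndex w hw) < w c :=
    fun c hc hcq h => hc.not_ge (pIndex_spec w hw (hi.trans hc) hcq hiq h)
  -- Otherwise `c` would be a candidate for q beyond q.
  have hend : ∀ c, qIndex w hw < c → w (qIndex w hw) < w c → w (pIndex w hw) < w c := by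
    intro c hc h
    refine lt_of_le_of_ne (not_lt.mp fun h1 => ?_) fun he => (hpq.trans hc).ne (w.injective he)
    exact hc.not_ge (le_qIndex w hw (hpq.trans hc) h1 hi (hiq.trans h))
  generalize pIndex w hw = p at *
  generalize qIndex w hw = q at *
  have hval : ∀ c, c ≠ p → c ≠ q → (w * swap p q) c = w c := fun c h1 h2 => by
    rw [Perm.mul_apply, swap_apply_of_ne_of_ne h1 h2]
  have hvp : (w * swap p q) p = w q := by rw [Perm.mul_apply, swap_apply_left]
  have hvq : (w * swap p q) q = w p := by rw [Perm.mul_apply, swap_apply_right]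
  rw [swap_comm j p]
  constructor
  · rintro ⟨hj, hc⟩
    rw [inv_mul_swap_eq_iff _ hj, hvp] at hc
    by_contra hne
    rw [hval j hj.ne' hne] at hc
    rcases lt_or_gt_of_ne hne with h | h
    · exact hmid j hj h hc.1
    -- Beyond `q`, the entry at `q` itself is intermediate and blocks the cover.
    · refine hc.2 q hpq h ?_
      rw [hvq]
      exact ⟨hqp, hend j h hc.1⟩
  · rintro rfl
    refine ⟨hpq, ?_⟩
    rw [inv_mul_swap_eq_iff _ hpq, hvp, hvq]
    refine ⟨hqp, fun c h1 h2 h3 => ?_⟩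
    rw [hval c h1.ne' h2.ne] at h3
    exact hmid c h1 h2 h3.1

/-- The rightmost smaller entry before `k` has nothing intermediate after it. -/
theorem exists_cover_left {k i : Fin n} (v : Perm (Fin n)) (hi : i < k) (hv : v i < v k) :
    ∃ i, i < k ∧ inv (v * swap i k) = inv v + 1 := by
  let S := Finset.univ.filter fun i : Fin n => i < k ∧ v i < v k
  have hS : S.Nonempty := ⟨i, Finset.mem_filter.mpr ⟨Finset.mem_univ _, hi, hv⟩⟩
  have hmax := (Finset.mem_filter.mp (S.max'_mem hS)).2
  refine ⟨S.max' hS, hmax.1, ?_⟩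
  rw [inv_mul_swap_eq_iff _ hmax.1]
  refine ⟨hmax.2, fun c h1 h2 h3 => ?_⟩
  exact h1.not_ge (S.le_max' c (Finset.mem_filter.mpr ⟨Finset.mem_univ _, h2, h3.2⟩))

theorem Phi_eq_of_nonempty {u : Perm (Fin n)} {k : Fin n} (h : (I u k).Nonempty) :
    Phi u k = (fun i => (⟨n, u * swap i k⟩ : Σ m : ℕ, Perm (Fin m))) '' I u k := by
  ext v
  constructor
  · intro hv
    cases hv with
    | child hi => exact ⟨_, hi, rfl⟩
    | shift he _ => exact absurd he h.ne_empty
  · rintro ⟨i, hi, rfl⟩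
    exact MemPhi.child hi

theorem I_eq_coe_filter (u : Perm (Fin n)) (k : Fin n) :
    I u k = (Finset.univ.filter fun i => i < k ∧ inv (u * swap i k) = inv u + 1 :
      Finset (Fin n)) := by
  ext i
  simp [I, length_eq_inv]

end StanleySymm

theorem mainTheorem4 {n : ℕ} (w : Equiv.Perm (Fin n)) (hw : ¬ StanleySymm.IsDominant w) :
    (∃ hfin : (StanleySymm.Phi
          (w * Equiv.swap (StanleySymm.pIndex w hw) (StanleySymm.qIndex w hw))
          (StanleySymm.pIndex w hw)).Finite,
        StanleySymm.stanley w = ∑ v ∈ hfin.toFinset, StanleySymm.stanley v.2) ∧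
      (StanleySymm.I
          (w * Equiv.swap (StanleySymm.pIndex w hw) (StanleySymm.qIndex w hw))
          (StanleySymm.pIndex w hw)).Nonempty ∧
      ∀ v ∈ StanleySymm.Phi
          (w * Equiv.swap (StanleySymm.pIndex w hw) (StanleySymm.qIndex w hw))
          (StanleySymm.pIndex w hw), v.1 = n := by
  open StanleySymm Equiv in
  have hcov := covers_right_pIndex w hw
  obtain ⟨hpq, hqp, i, hi, hiq⟩ := qIndex_mem w hw
  generalize pIndex w hw = p at *
  generalize qIndex w hw = q at *
  set u := w * swap p q with hu
  have hup : u p = w q := by rw [hu, Perm.mul_apply, swap_apply_left]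
  have huq : u q = w p := by rw [hu, Perm.mul_apply, swap_apply_right]
  have hui : u i = w i := by
    rw [hu, Perm.mul_apply, swap_apply_of_ne_of_ne hi.ne (hi.trans hpq).ne]
  have hI : (I u p).Nonempty := by
    obtain ⟨j, hj⟩ := exists_cover_left u hi (by rwa [hui, hup])
    exact ⟨j, by rw [I_eq_coe_filter]; simpa using hj⟩
  -- Position `q` holds a larger entry to the right of `p`, and `i` a smaller one to its left.
  have hext : ¬ IsExtremal p u := by
    rintro (h | h)
    · have := h q hpq
      rw [hup, huq] at this
      exact lt_asymm this hqp
    · have := h i hi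
      rw [hup, hui] at this
      exact lt_asymm this hiq
  have hPhi := Phi_eq_of_nonempty hI
  have hfin : (Phi u p).Finite := by
    rw [hPhi]
    exact (Set.toFinite _).image _
  refine ⟨⟨hfin, ?_⟩, hI, ?_⟩
  · have htrans := sum_covers_left_eq_sum_covers_right p u hext
    have hright : (Finset.univ.filter fun j => p < j ∧ inv (u * swap j p) = inv u + 1) = {q} := by
      ext j
      simpa using hcov j
    have huw : u * swap q p = w := by rw [hu, mul_assoc, swap_comm q p, swap_mul_self, mul_one]
    rw [hright, Finset.sum_singleton, huw] at htrans
    have himage : hfin.toFinset =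
        (Finset.univ.filter fun i => i < p ∧ inv (u * swap i p) = inv u + 1).image
          fun i => (⟨n, u * swap i p⟩ : Σ m : ℕ, Perm (Fin m)) := by
      apply Finset.coe_injective
      rw [Set.Finite.coe_toFinset, hPhi, Finset.coe_image, I_eq_coe_filter]
    rw [← htrans, himage, Finset.sum_image]
    intro a _ b _ hab
    have h1 : u * swap a p = u * swap b p := by simpa using hab
    exact swap_injective_of_right p (mul_left_cancel h1)
  · intro v hv
    rw [hPhi] at hv
    obtain ⟨j, -, rfl⟩ := hv
    rfl
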